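/- A hypergraph is finite: it has a finite vertex set $V(\mathcal H)$ and a set $E(\mathcal H)$ of subsets of $V(\mathcal H)$ as edges; two vertices are adjacent if some edge contains both. The $2$-section $[\mathcal H]_2$ is the graph on $V(\mathcal H)$ in which distinct vertices are joined if and only if they are adjacent in $\mathcal H$, and $\mathcal H$ is connected if $[\mathcal H]_2$ is connected (in particular, $V(\mathcal H)\neq\emptyset$). Graphs are the hypergraphs all of whose edges have size $2$; $\delta$ denotes the minimum degree of a graph, and a tree is non-trivial if it has at least two vertices. The Cartesian product $\mathcal G\,\square\,\mathcal H$ has vertex set $V(\mathcal G)\times V(\mathcal H)$, and its edges are the sets $\{a\}\times f$ with $a\in V(\mathcal G)$, $f\in E(\mathcal H)$, and $e\times\{b\}$ with $e\in E(\mathcal G)$, $b\in V(\mathcal H)$; the product of several hypergraphs $\mathcal H_1,\dots,\mathcal H_d$ has the tuples of vertices as its vertices, and its edges are the sets obtained from a vertex by letting one coordinate $i$ range over an edge of $\mathcal H_i$ while all other coordinates stay fixed. In the game of Cops and Robber on $\mathcal H$, the cop player places $k$ cops on vertices, and then the robber player places the robber on a vertex. They then move alternately, starting with the cop player: in a move,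 each cop (respectively, the robber) stays or goes to an adjacent vertex. Several cops may occupy the same vertex, and all positions are known to both players. The cop player wins if after finitely many moves some cop is at the vertex of the robber. The cop number $c(\mathcal H)$ is the least $k$ for which the cop player has a winning strategy with $k$ cops. **Theorem.** (a) Let $\mathcal G$ and $\mathcal H$ be connected hypergraphs on at least $2$ vertices. Then \[ \max(c(\mathcal G),c(\mathcal H),2)\le c(\mathcal G\,\square\,\mathcal H)\le c(\mathcal G)+c(\mathcal H). \] In particular, if $c(\mathcal G)=c(\mathcal H)=1$, then $c(\mathcal G\,\square\,\mathcal H)=2$. (b) Let $p\ge 0$ and $q\ge 1$. Let $T_1,\dots,T_p$ be non-trivial trees, and let $\mathcal H_1,\dots,\mathcal H_q$ be connected hypergraphs with $c(\mathcal H_j)=1$ and $\delta([\mathcal H_j]_2)\ge 2$ for every $1\le j\le q$. Let $\mathcal H$ be the Cartesian product of these trees and hypergraphs. Then \[ c(\mathcal H)=\Big\lceil\frac p2\Big\rceil+q. \] -/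

import Mathlib

open scoped Hypergraph

namespace Hypergraph

/-- The `2`-section of `H`: the simple graph on the vertices of `H` in which two distinct vertices
are joined when some edge of `H` contains both. -/
def twoSection {α : Type*} (H : Hypergraph α) : SimpleGraph V(H) where
  Adj x y := x ≠ y ∧ H.Adj x y
  symm := ⟨fun _ _ h => ⟨h.1.symm, h.2.symm⟩⟩
  loopless := ⟨fun _ h => h.1 rfl⟩

/-- `H` is a tree, i.e. all its edges have size two and, as a graph, it is a tree. -/
def IsTree {α : Type*} (H : Hypergraph α) : Prop :=
  (∀ e ∈ E(H), e.ncard = 2) ∧ H.twoSection.IsTree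

/-- The Cartesian product of two hypergraphs, with edges `{a} × f` and `e × {b}`. -/
def box {α β : Type*} (G : Hypergraph α) (H : Hypergraph β) : Hypergraph (α × β) where
  vertexSet := V(G) ×ˢ V(H)
  edgeSet := {s | (∃ a ∈ V(G), ∃ f ∈ E(H), s = {a} ×ˢ f) ∨
    (∃ e ∈ E(G), ∃ b ∈ V(H), s = e ×ˢ {b})}
  subset_vertexSet_of_mem_edgeSet' := by
    rintro s (⟨a, ha, f, hf, rfl⟩ | ⟨e, he, b, hb, rfl⟩)
    · exact Set.prod_mono (Set.singleton_subset_iff.2 ha) (H.subset_vertexSet_of_mem_edgeSet' hf)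
    · exact Set.prod_mono (G.subset_vertexSet_of_mem_edgeSet' he) (Set.singleton_subset_iff.2 hb)

/-- The Cartesian product of a family of hypergraphs. Its vertices are the tuples of vertices of
the factors; an edge is obtained by letting one coordinate `i` range over an edge `e` of the `i`-th
factor, while all the other coordinates stay fixed (at those of a vertex `a`). -/
def piBox {ι : Type*} {α : ι → Type*} (H : ∀ i, Hypergraph (α i)) : Hypergraph (∀ i, α i) where
  vertexSet := {x | ∀ i, x i ∈ V(H i)}
  edgeSet := {s | ∃ i, ∃ e ∈ E(H i), ∃ a : ∀ j, α j, (∀ j, a j ∈ V(H j)) ∧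
    s = {x | x i ∈ e ∧ ∀ j, j ≠ i → x j = a j}}
  subset_vertexSet_of_mem_edgeSet' := by
    rintro s ⟨i, e, he, a, ha, rfl⟩ x ⟨hxi, hx⟩ j
    by_cases hj : j = i
    · subst hj
      exact (H j).subset_vertexSet_of_mem_edgeSet' he hxi
    · rw [hx j hj]
      exact ha j

/-- The possible sequences of positions of a single piece (a cop or the robber) on `H`: it always
sits at a vertex, and at each turn it stays where it is or moves to an adjacent vertex. -/
def IsTrajectory {α : Type*} (H : Hypergraph α) (w : ℕ → α) : Prop :=
  (∀ n, w n ∈ V(H)) ∧ ∀ n, w (n + 1) = w n ∨ H.Adj (w n) (w (n + 1))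

/-- The cop player has a winning strategy with `k` cops in the game of Cops and Robber on `H`.

A strategy `σ` tells the positions of the `k` cops as a function of the list of all past positions
of the robber: `σ []` is the initial placement, made before the robber is placed, and
`σ [r 0, …, r (n - 1)]` is the position of the cops in round `n`, chosen before the robber goes
from `r (n - 1)` to `r n`. The strategy has to be legal and to capture the robber after finitely
many moves, whatever he does. A capture occurs when the robber, placed at or moved to `r n`, is at
the position of a cop, or when a cop then moves to `r n`. -/
def IsCopWin {α : Type*} (H : Hypergraph α) (k : ℕ) : Prop :=
  ∃ σ : List α → Fin k → α, ∀ r : ℕ → α, H.IsTrajectory r →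
    (∀ i, H.IsTrajectory fun n => σ ((List.range n).map r) i) ∧
    ∃ n i, σ ((List.range n).map r) i = r n ∨ σ ((List.range (n + 1)).map r) i = r n

/-- The cop number of `H`: the least number of cops with which the cop player has a winning
strategy. -/
noncomputable def copNumber {α : Type*} (H : Hypergraph α) : ℕ :=
  sInf {k | H.IsCopWin k}

end Hypergraph

/-! The game depends only on the `2`-section, so it is played on graphs. `CopsWin` says by induction
that the cops can force a capture; the robber's moves are a parameter, so that a robber who may
never stay can be treated too.

The upper bounds rest on `AllWin.boxProd`: if `m + 1` cops win on `A`, `m` cops win on `A` against a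
robber who must always move, and `h` cops win on `K`, then `h + m` cops win on `A □ K`. Once `h`
cops share the robber's `A`-coordinate, they copy each of his moves in `A` and advance their game on
`K` whenever he does anything else. Hence he can only delay by moving in `A` without pause, and then
the other `m` cops catch him. The choice `m = c(A)` gives the upper bound in (a). On a product of
two trees two cops win, and a parity argument shows that one cop suffices against a robber who may
never stay (`IsTree.allWin_boxProd`). So `m = 1` is possible there, and each pair of trees costs a
single cop, whence the `⌈p / 2⌉` in (b).

For the lower bounds in (a), each factor is a retract of the product, and a single cop is evaded by
keeping both coordinates different from his. In (b), the robber has `p + 2q` chosen exits, one in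
each tree and two in each other factor. A cop elsewhere guards at most two of them, so `2k ≥ p + 2q`
cops are needed to trap him (`sum_le_two_mul_of_placement`). -/

namespace SimpleGraph

/-! ### Winning positions of the game on a graph -/

/-- A move of a piece along `Γ`: it stays where it is or goes to a neighbour. -/
def Step {V : Type*} (Γ : SimpleGraph V) (x y : V) : Prop := x = y ∨ Γ.Adj x y

lemma Step.refl {V : Type*} (Γ : SimpleGraph V) (x : V) : Γ.Step x x := Or.inl rfl

lemma Connected.exists_adj_dist_add_one {V : Type*} {Γ : SimpleGraph V} (hΓ : Γ.Connected)
    {x y : V} (h : x ≠ y) : ∃ z, Γ.Adj x z ∧ Γ.dist z y + 1 = Γ.dist x y := by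
  obtain ⟨w, hw⟩ := hΓ.exists_walk_length_eq_dist x y
  cases w with
  | nil => exact (h rfl).elim
  | @cons _ z _ hz w =>
    refine ⟨z, hz, ?_⟩
    have h₁ := dist_le w
    have h₂ := hΓ.dist_triangle (u := x) (v := z) (w := y)
    have h₃ := dist_eq_one_iff_adj.2 hz
    rw [Walk.length_cons] at hw
    omega

/-- The cops at the positions `c` can force a capture of the robber at `r`, when it is the turn of
the robber and his moves are given by the relation `R`. -/
inductive CopsWin {V ι : Type*} (Γ : SimpleGraph V) (R : V → V → Prop) : (ι → V) → V → Prop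
  | capture (c : ι → V) (r : V) (i : ι) (h : c i = r) : CopsWin Γ R c r
  | move (c : ι → V) (r : V) (f : V → ι → V) (hf : ∀ r', R r r' → ∀ i, Γ.Step (c i) (f r' i))
      (h : ∀ r', R r r' → CopsWin Γ R (f r') r') : CopsWin Γ R c r

/-- `n` cops win against a robber with moves `R` from every initial position. -/
def AllWin {V : Type*} (Γ : SimpleGraph V) (R : V → V → Prop) (n : ℕ) : Prop :=
  ∀ (c : Fin n → V) (r : V), Γ.CopsWin R c r

namespace CopsWin

variable {V ι : Type*} {Γ : SimpleGraph V} {R : V → V → Prop}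

lemma of_forall_exists {c : ι → V} {r : V}
    (h : ∀ r', R r r' → ∃ c' : ι → V, (∀ i, Γ.Step (c i) (c' i)) ∧ Γ.CopsWin R c' r') :
    Γ.CopsWin R c r := by
  have : Nonempty V := ⟨r⟩
  choose! f hf hw using h
  exact .move c r f hf hw

lemma mono {R' : V → V → Prop} (hR : ∀ x y, R' x y → R x y) {c : ι → V} {r : V}
    (h : Γ.CopsWin R c r) : Γ.CopsWin R' c r := by
  induction h with
  | capture c r i h => exact .capture c r i h
  | move c r f hf _ ih =>
    exact .move c r f (fun r' h => hf r' (hR _ _ h)) fun r' h => ih r' (hR _ _ h)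

lemma of_comp {κ : Type*} {e : κ → ι} (he : Function.Injective e) {c : κ → V} {r : V}
    (h : Γ.CopsWin R c r) : ∀ d : ι → V, (∀ k, d (e k) = c k) → Γ.CopsWin R d r := by
  classical
  induction h with
  | capture c r k h => exact fun d hd => .capture d r (e k) ((hd k).trans h)
  | move c r f hf _ ih =>
    refine fun d hd => .move d r (fun r' => Function.extend e (f r') d) (fun r' hr i => ?_)
      fun r' hr => ih r' hr _ fun k => he.extend_apply _ _ _
    by_cases hi : ∃ k, e k = i
    · obtain ⟨k, rfl⟩ := hi
      rw [he.extend_apply, hd]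
      exact hf r' hr k
    · rw [Function.extend_apply' _ _ _ hi]
      exact Step.refl _ _

/-- If `V` is a retract of `W`, then a win on `W` against the image of the robber gives a win
on `V`. -/
lemma of_retract {W : Type*} {Δ : SimpleGraph W} {S : W → W → Prop} (f : W → V) (s : V → W)
    (hfs : ∀ x, f (s x) = x) (hf : ∀ x y, Δ.Step x y → Γ.Step (f x) (f y))
    (hs : ∀ x y, R x y → S (s x) (s y)) {c : ι → W} {w : W} (h : Δ.CopsWin S c w) :
    ∀ r, w = s r → Γ.CopsWin R (fun i => f (c i)) r := by
  induction h with
  | capture c w i h =>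
    rintro r rfl
    exact .capture _ r i (by rw [h, hfs])
  | move c w g hg _ ih =>
    rintro r rfl
    exact .move _ r (fun r' i => f (g (s r') i)) (fun r' hr i => hf _ _ (hg _ (hs _ _ hr) i))
      fun r' hr => ih _ (hs _ _ hr) r' rfl

/-- The cops may first gather at given positions, if these win whenever the robber is in a set `P`
that he cannot leave. -/
lemma gather [Fintype ι] (hΓ : Γ.Connected) (P : V → Prop) (hP : ∀ x y, R x y → P x → P y)
    (c₀ : ι → V) (h : ∀ r, P r → Γ.CopsWin R c₀ r) (c : ι → V) (r : V) (hr : P r) :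
    Γ.CopsWin R c r := by
  -- Induction on the total distance of the cops from their targets.
  have key : ∀ n, ∀ (c : ι → V) (r : V), P r → ∑ i, Γ.dist (c i) (c₀ i) = n →
      Γ.CopsWin R c r := by
    intro n
    induction n using Nat.strong_induction_on with
    | _ n ih =>
      intro c r hr hn
      by_cases hc : c = c₀
      · exact hc ▸ h r hr
      have hstep : ∀ i, ∃ y, Γ.Step (c i) y ∧
          Γ.dist y (c₀ i) ≤ Γ.dist (c i) (c₀ i) ∧
          (c i ≠ c₀ i → Γ.dist y (c₀ i) < Γ.dist (c i) (c₀ i)) := by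
        intro i
        by_cases hi : c i = c₀ i
        · exact ⟨c i, Step.refl _ _, le_rfl, fun h => (h hi).elim⟩
        · obtain ⟨y, hy, hd⟩ := hΓ.exists_adj_dist_add_one hi
          exact ⟨y, Or.inr hy, by omega, fun _ => by omega⟩
      choose c' h₁ h₂ h₃ using hstep
      refine .move c r (fun _ => c') (fun _ _ => h₁) fun r' hr' =>
        ih _ ?_ c' r' (hP _ _ hr' hr) rfl
      obtain ⟨i, hi⟩ := Function.ne_iff.1 hc
      rw [← hn]
      exact Finset.sum_lt_sum (fun i _ => h₂ i) ⟨i, Finset.mem_univ _, h₃ i hi⟩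
  exact key _ c r hr rfl

end CopsWin

variable {V : Type*} {Γ : SimpleGraph V} {R : V → V → Prop}

lemma AllWin.copsWin {ι : Type*} [Finite ι] {n : ℕ} (h : Γ.AllWin R n) (hn : n ≤ Nat.card ι)
    (c : ι → V) (r : V) : Γ.CopsWin R c r := by
  have := Fintype.ofFinite ι
  obtain ⟨e⟩ : Nonempty (Fin n ↪ ι) := Function.Embedding.nonempty_of_card_le (by
    simpa [Nat.card_eq_fintype_card] using hn)
  exact (h (fun k => c (e k)) r).of_comp e.injective c fun _ => rfl

lemma AllWin.of_le {m n : ℕ} (h : Γ.AllWin R m) (hmn : m ≤ n) : Γ.AllWin R n :=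
  fun c r => h.copsWin (by simpa using hmn) c r

lemma AllWin.of_retract {W : Type*} {Δ : SimpleGraph W} {n : ℕ} (h : Δ.AllWin Δ.Step n)
    (f : W → V) (s : V → W) (hfs : ∀ x, f (s x) = x)
    (hf : ∀ x y, Δ.Step x y → Γ.Step (f x) (f y)) (hs : ∀ x y, Γ.Step x y → Δ.Step (s x) (s y)) :
    Γ.AllWin Γ.Step n := by
  intro c r
  have := (h (fun i => s (c i)) (s r)).of_retract f s hfs hf hs r rfl
  simpa only [hfs] using this

lemma AllWin.of_placement (hΓ : Γ.Connected) {n : ℕ} (c₀ : Fin n → V)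
    (h : ∀ r, ∃ c, (∀ i, Γ.Step (c₀ i) (c i)) ∧ Γ.CopsWin Γ.Step c r) : Γ.AllWin Γ.Step n :=
  fun c r => CopsWin.gather hΓ (fun _ => True) (fun _ _ _ _ => trivial) c₀
    (fun _ _ => CopsWin.of_forall_exists fun r' _ => h r') c r trivial

end SimpleGraph

/-! ### Upper bounds for a product of two graphs -/

namespace SimpleGraph

lemma step_boxProd {U V : Type*} {A : SimpleGraph U} {K : SimpleGraph V} {x y : U × V} :
    (A □ K).Step x y ↔ A.Step x.1 y.1 ∧ x.2 = y.2 ∨ x.1 = y.1 ∧ K.Step x.2 y.2 := by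
  simp only [Step, boxProd_adj, Prod.ext_iff]
  tauto

lemma step_boxProd_of_left {U V : Type*} {A : SimpleGraph U} {K : SimpleGraph V} {a b : U} {k : V}
    (h : A.Step a b) : (A □ K).Step (a, k) (b, k) := step_boxProd.2 (Or.inl ⟨h, rfl⟩)

lemma step_boxProd_of_right {U V : Type*} {A : SimpleGraph U} {K : SimpleGraph V} {a : U} {k l : V}
    (h : K.Step k l) : (A □ K).Step (a, k) (a, l) := step_boxProd.2 (Or.inr ⟨rfl, h⟩)

variable {U V : Type*} {A : SimpleGraph U} {K : SimpleGraph V}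

/-- If the cops win on `A` against a robber who may never stay, then they win on `A □ K` against a
robber who makes proper moves in the first coordinate only. -/
lemma CopsWin.boxProd_left (hA : A.Connected) (hK : K.Connected) {ι : Type*} [Fintype ι]
    (h : ∀ (c : ι → U) r, A.CopsWin A.Adj c r) (c : ι → U × V) (r : U × V) :
    (A □ K).CopsWin (fun x y => A.Adj x.1 y.1 ∧ x.2 = y.2) c r := by
  -- The robber never leaves his layer. Gathering at his initial vertex brings all cops into it, and
  -- there the game is the one on `A`.
  refine CopsWin.gather (hA.boxProd hK) (fun x => x.2 = r.2) (fun x y hxy hx => hxy.2.symm.trans hx)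
    (fun _ => r) ?_ c r rfl
  have key : ∀ (c : ι → U) (a : U), A.CopsWin A.Adj c a →
      (A □ K).CopsWin (fun x y => A.Adj x.1 y.1 ∧ x.2 = y.2) (fun i => (c i, r.2)) (a, r.2) := by
    intro c a hc
    induction hc with
    | capture c a i h => exact .capture _ _ i (by rw [h])
    | move c a f hf _ ih =>
      refine .move _ _ (fun x i => (f x.1 i, r.2))
        (fun x hx i => step_boxProd_of_left (hf _ hx.1 i)) ?_
      rintro ⟨a', k⟩ ⟨ha, rfl⟩
      exact ih a' ha
  rintro ⟨a, k⟩ (rfl : k = r.2)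
  exact key _ a (h (fun _ => r.1) a)

/-- The cops in `J` shadow the robber in the first coordinate, and play on `K` in the second one.
The other cops make use of all the moves of the robber in the first coordinate. -/
lemma CopsWin.boxProd_of_shadow {ι : Type*} (J : Set ι)
    (hact : ∀ (c : ↥Jᶜ → U × V) r,
      (A □ K).CopsWin (fun x y => A.Adj x.1 y.1 ∧ x.2 = y.2) c r)
    {d : J → V} {k : V} (h : K.CopsWin K.Step d k) :
    ∀ (c : ι → U × V) (a : U), (∀ i : J, c i = (a, d i)) →
      (A □ K).CopsWin (A □ K).Step c (a, k) := by
  classical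
  induction h with
  | capture d k i h => exact fun c a hc => .capture _ _ i (by rw [hc, h])
  | move d k f hf _ ih =>
    intro c a hc
    -- Inner induction on the game of the active cops. It ends in a capture, or with a move that is
    -- not a proper move in `A`; such a move advances the outer induction on the game on `K`, after
    -- which the active cops start afresh.
    have key : ∀ (e : ↥Jᶜ → U × V) (x : U × V),
        (A □ K).CopsWin (fun x y => A.Adj x.1 y.1 ∧ x.2 = y.2) e x → x.2 = k →
        ∀ c : ι → U × V, (∀ i : J, c i = (x.1, d i)) → (∀ i : ↥Jᶜ, c i = e i) →
        (A □ K).CopsWin (A □ K).Step c x := by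
      intro e x he
      induction he with
      | capture e x i h => exact fun _ c _ hc => .capture _ _ i (by rw [hc, h])
      | move e x g hg _ ihA =>
        rintro hx c hcJ hce
        refine CopsWin.of_forall_exists fun y hxy => ?_
        -- Staying counts as a move in `K`, so that the moves left for `A` are proper.
        have hxy' : A.Adj x.1 y.1 ∧ x.2 = y.2 ∨ x.1 = y.1 ∧ K.Step x.2 y.2 := by
          rcases step_boxProd.1 hxy with ⟨h | h, h'⟩ | h
          · exact Or.inr ⟨h, Or.inl h'⟩
          · exact Or.inl ⟨h, h'⟩
          · exact Or.inr h
        rcases hxy' with hy | ⟨hy, hy'⟩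
        · refine ⟨fun i => if hi : i ∈ J then (y.1, d ⟨i, hi⟩) else g y ⟨i, hi⟩, fun i => ?_,
            ihA y hy (hy.2 ▸ hx) _ (fun i => by simp) fun i => ?_⟩
          · by_cases hi : i ∈ J
            · beta_reduce
              rw [hcJ ⟨i, hi⟩, dif_pos hi]
              exact step_boxProd_of_left (Or.inr hy.1)
            · beta_reduce
              rw [hce ⟨i, hi⟩, dif_neg hi]
              exact hg y hy ⟨i, hi⟩
          · rw [dif_neg i.2]
        · rw [hx] at hy'
          refine ⟨fun i => if hi : i ∈ J then (y.1, f y.2 ⟨i, hi⟩) else c i, fun i => ?_, ?_⟩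
          · by_cases hi : i ∈ J
            · beta_reduce
              rw [hcJ ⟨i, hi⟩, dif_pos hi, hy]
              exact step_boxProd_of_right (hf _ hy' _)
            · beta_reduce
              rw [dif_neg hi]
              exact Step.refl _ _
          · exact ih y.2 hy' _ y.1 fun i => by simp
    exact key _ _ (hact (fun i => c i) (a, k)) rfl c hc fun _ => rfl

/-- If the cops win on `A □ K` whenever the cops of a set one larger shadow the robber in the first
coordinate, and enough cops remain to play on `A`, then they win. -/
lemma CopsWin.boxProd_of_insert_shadow {ι : Type*} (J : Set ι)
    (h : ∀ (i : ι) (c : ι → U × V) r, i ∉ J → (∀ j ∈ insert i J, (c j).1 = r.1) →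
      (A □ K).CopsWin (A □ K).Step c r)
    {d : ↥Jᶜ → U} {a : U} (hd : A.CopsWin A.Step d a) :
    ∀ (c : ι → U × V) (k : V), (∀ j ∈ J, (c j).1 = a) → (∀ j : ↥Jᶜ, (c j).1 = d j) →
      (A □ K).CopsWin (A □ K).Step c (a, k) := by
  classical
  induction hd with
  | capture d a i hi =>
    refine fun c k hc hd => h i c _ i.2 fun j hj => ?_
    rcases hj with rfl | hj
    · rw [hd, hi]
    · exact hc j hj
  | move d a f hf _ ih =>
    intro c k hc hd
    have hstep : ∀ y, (A □ K).Step (a, k) y → A.Step a y.1 := by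
      intro y hy
      rcases step_boxProd.1 hy with h | h
      · exact h.1
      · exact Or.inl h.1
    refine .move _ _ (fun y i => if hi : i ∈ J then (y.1, (c i).2) else (f y.1 ⟨i, hi⟩, (c i).2))
      (fun y hy i => ?_) fun y hy => ih y.1 (hstep y hy) _ y.2 (fun j hj => ?_) fun j => ?_
    · by_cases hi : i ∈ J
      · simp only [hi, dif_pos]
        exact step_boxProd.2 (Or.inl ⟨(hc i hi).symm ▸ hstep y hy, rfl⟩)
      · simp only [hi, dif_neg, not_false_eq_true]
        exact step_boxProd.2 (Or.inl ⟨(hd ⟨i, hi⟩).symm ▸ hf _ (hstep y hy) _, rfl⟩)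
    · simp [hj]
    · have hj : (j : ι) ∉ J := j.2
      simp [hj]

/-- Shadows are recruited one at a time. While fewer than `h` cops shadow the robber, at least `m +
1` others remain, enough to catch his projection to `A` and so gain another shadow. In `key`, `J` is
the set of shadows and `n` the number still missing. -/
theorem AllWin.boxProd (hA : A.Connected) (hK : K.Connected) {h m : ℕ}
    (hAm : A.AllWin A.Step (m + 1)) (hact : A.AllWin A.Adj m) (hKh : K.AllWin K.Step h) :
    (A □ K).AllWin (A □ K).Step (h + m) := by
  have key : ∀ n j, j + n = h → ∀ J : Set (Fin (h + m)), J.ncard = j →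
      ∀ (c : Fin (h + m) → U × V) r, (∀ i ∈ J, (c i).1 = r.1) →
      (A □ K).CopsWin (A □ K).Step c r := by
    intro n
    induction n with
    | zero =>
      intro j hj J hJ c r hc
      refine CopsWin.boxProd_of_shadow J ?_
        (hKh.copsWin (ι := J) (by rw [Nat.card_coe_set_eq]; omega) (fun i => (c i).2) r.2) c r.1
        fun i => by rw [← hc i i.2]
      have := Fintype.ofFinite ↥Jᶜ
      refine CopsWin.boxProd_left hA hK (hact.copsWin ?_)
      have := Set.ncard_add_ncard_compl J
      rw [Nat.card_coe_set_eq]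
      simp at this
      omega
    | succ n ih =>
      intro j hj J hJ c r hc
      refine CopsWin.boxProd_of_insert_shadow J (fun i c r hi hc => ?_)
        (hAm.copsWin (ι := ↥Jᶜ) ?_ (fun i => (c i).1) r.1) c r.2 hc fun _ => rfl
      · exact ih (j + 1) (by omega) _ (by rw [Set.ncard_insert_of_notMem hi, hJ]) c r hc
      · have := Set.ncard_add_ncard_compl J
        rw [Nat.card_coe_set_eq]
        simp at this
        omega
  exact fun c r => key h 0 (by omega) ∅ (by simp) c r (by simp)

theorem AllWin.boxProd_add (hA : A.Connected) (hK : K.Connected) {g h : ℕ}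
    (hAg : A.AllWin A.Step g) (hKh : K.AllWin K.Step h) :
    (A □ K).AllWin (A □ K).Step (g + h) :=
  add_comm h g ▸ AllWin.boxProd hA hK (hAg.of_le g.le_succ)
    (fun c r => (hAg c r).mono fun _ _ => Or.inr) hKh

end SimpleGraph

/-! ### Pursuit on a product of two trees -/

namespace SimpleGraph

variable {U V : Type*} {S : SimpleGraph U} {T : SimpleGraph V}

lemma IsTree.eq_of_adj_of_dist_add_one (hT : T.IsTree) {x y z v : V} (hy : T.Adj x y)
    (hz : T.Adj x z) (hyv : T.dist y v + 1 = T.dist x v) (hzv : T.dist z v + 1 = T.dist x v) :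
    y = z := by
  obtain ⟨p, hp⟩ := hT.connected.exists_walk_length_eq_dist y v
  obtain ⟨q, hq⟩ := hT.connected.exists_walk_length_eq_dist z v
  have hp' : (Walk.cons hy p).IsPath := Walk.isPath_of_length_eq_dist _ (by simp [hp, hyv])
  have hq' : (Walk.cons hz q).IsPath := Walk.isPath_of_length_eq_dist _ (by simp [hq, hzv])
  have h := congrArg (fun p : T.Path x v => (p : T.Walk x v).snd)
    ((hT.isAcyclic.subsingleton_path x v).elim ⟨_, hp'⟩ ⟨_, hq'⟩)
  simpa using h

/-- The vertices that lie beyond `r` from the point of view of `c`. -/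
def beyond (T : SimpleGraph V) (c r : V) : Set V := {v | T.dist c v = T.dist c r + T.dist r v}

/-- When the robber flees and the cop follows, the region beyond the robber loses at least the
vertex `r` that he left, and gains nothing because paths in a tree are unique. -/
lemma IsTree.ncard_beyond_lt [Finite V] (hT : T.IsTree) {c c' r r' : V} (hr : T.Adj r r')
    (hcr : T.dist c r' = T.dist c r + 1) (hc : T.Adj c c') (hc' : T.dist c' r + 1 = T.dist c r) :
    (T.beyond c' r').ncard < (T.beyond c r).ncard := by
  have hrr := dist_eq_one_iff_adj.2 hr
  have hrr' := dist_eq_one_iff_adj.2 hr.symm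
  have hcc := dist_eq_one_iff_adj.2 hc
  have h₁ := hT.connected.dist_triangle (u := c) (v := c') (w := r')
  have h₂ := hT.connected.dist_triangle (u := c') (v := r) (w := r')
  refine Set.ncard_lt_ncard (Set.ssubset_iff_exists.2 ⟨fun v hv => ?_, r, ?_, ?_⟩)
  · simp only [beyond, Set.mem_ofPred_eq] at hv ⊢
    have h₃ := hT.connected.dist_triangle (u := r) (v := r') (w := v)
    have h₄ := hT.connected.dist_triangle (u := c') (v := r) (w := v)
    rcases hT.dist_eq_dist_add_one_of_adj v hc with h | h
    · rw [dist_comm (u := v), dist_comm (u := v)] at h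
      omega
    · rw [dist_comm (u := v), dist_comm (u := v)] at h
      have hne : c' ≠ r' := by
        rintro rfl
        simp at h₁
        omega
      -- The step `w` from `c'` towards `r'` also leads towards `v`. If `c` were closer to `v` than
      -- `c'`, uniqueness would give `w = c`, but `c` is not closer to `r'`.
      obtain ⟨w, hw, hwr⟩ := hT.connected.exists_adj_dist_add_one hne
      have h₅ := hT.connected.dist_triangle (u := w) (v := r') (w := v)
      have h₆ := hT.connected.dist_triangle (u := c') (v := w) (w := v)
      have h₇ := dist_eq_one_iff_adj.2 hw
      have : w = c := hT.eq_of_adj_of_dist_add_one hw hc.symm (by omega) h.symm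
      subst this
      omega
  · simp [beyond]
  · simp only [beyond, Set.mem_ofPred_eq]
    omega

/-- The progress of a cop at `c` who pursues a robber at `r` on a product of two trees. -/
noncomputable def pursuit (S : SimpleGraph U) (T : SimpleGraph V) (c r : U × V) : ℕ ×ₗ ℕ ×ₗ ℕ :=
  toLex (S.dist c.1 r.1 + T.dist c.2 r.2,
    toLex ((S.dist c.1 r.1 - T.dist c.2 r.2) + (T.dist c.2 r.2 - S.dist c.1 r.1),
      (S.beyond c.1 r.1).ncard + (T.beyond c.2 r.2).ncard))

lemma pursuit_swap (c r : U × V) : pursuit T S c.swap r.swap = pursuit S T c r := by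
  simp only [pursuit, Prod.fst_swap, Prod.snd_swap, add_comm]

/-- After the robber's move the two distances have odd sum, so they differ, and the cop moves in the
coordinate with the larger one. If the robber approached, the sum drops. If he increased the
distance that is still smaller, the sum is kept and the difference drops. Otherwise both are kept,
and the region beyond him shrinks. -/
lemma exists_pursuit_lt [Finite U] (hS : S.IsTree) (hT : T.IsTree) {c r : U × V}
    {x : U} (hx : S.Adj r.1 x) (h₀ : S.dist c.1 r.1 + T.dist c.2 r.2 ≠ 0)
    (h₂ : Even (S.dist c.1 r.1 + T.dist c.2 r.2)) :
    ∃ c' : U × V, (S □ T).Adj c c' ∧ Even (S.dist c'.1 x + T.dist c'.2 r.2) ∧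
      pursuit S T c' (x, r.2) < pursuit S T c r := by
  obtain ⟨c₁, c₂⟩ := c
  obtain ⟨r₁, r₂⟩ := r
  simp only [Nat.even_iff, pursuit, Prod.Lex.toLex_lt_toLex] at *
  have hd := hS.dist_eq_dist_add_one_of_adj c₁ hx
  by_cases h : S.dist c₁ x < T.dist c₂ r₂
  · obtain ⟨y, hy, hd'⟩ := hT.connected.exists_adj_dist_add_one (x := c₂) (y := r₂) (by
      rintro rfl
      simp at h)
    refine ⟨(c₁, y), by simpa using hy, ?_⟩
    dsimp only
    omega
  · rcases hd with hd | hd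
    · obtain ⟨y, hy, hd'⟩ := hS.connected.exists_adj_dist_add_one (x := c₁) (y := x) (by
        rintro rfl
        rw [dist_self] at *
        omega)
      refine ⟨(y, c₂), by simpa using hy, ?_⟩
      dsimp only
      omega
    · obtain ⟨y, hy, hd'⟩ := hS.connected.exists_adj_dist_add_one (x := c₁) (y := r₁) (by
        rintro rfl
        rw [dist_self] at *
        omega)
      have hb := hS.ncard_beyond_lt hx hd hy hd'
      have h₃ := hS.connected.dist_triangle (u := c₁) (v := y) (w := x)
      have h₄ := hS.connected.dist_triangle (u := y) (v := r₁) (w := x)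
      have h₅ := dist_eq_one_iff_adj.2 hy
      have h₆ := dist_eq_one_iff_adj.2 hx
      refine ⟨(y, c₂), by simpa using hy, ?_⟩
      dsimp only
      omega

lemma IsTree.copsWin_boxProd_of_even [Finite U] [Finite V] (hS : S.IsTree) (hT : T.IsTree)
    {ι : Type*} [Nonempty ι] (c r : U × V) (h : Even (S.dist c.1 r.1 + T.dist c.2 r.2)) :
    (S □ T).CopsWin (S □ T).Adj (fun _ : ι => c) r := by
  by_cases h₀ : S.dist c.1 r.1 + T.dist c.2 r.2 = 0
  · refine .capture _ _ (Classical.arbitrary ι) (Prod.ext ?_ ?_)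
    · exact hS.connected.dist_eq_zero_iff.1 (by omega)
    · exact hT.connected.dist_eq_zero_iff.1 (by omega)
  refine CopsWin.of_forall_exists fun r' hr => ?_
  have key : ∃ c' : U × V, (S □ T).Adj c c' ∧ Even (S.dist c'.1 r'.1 + T.dist c'.2 r'.2) ∧
      pursuit S T c' r' < pursuit S T c r := by
    rcases boxProd_adj.1 hr with ⟨hr, hr'⟩ | ⟨hr, hr'⟩
    · obtain ⟨c', h₁, h₂, h₃⟩ := exists_pursuit_lt hS hT hr h₀ h
      rw [hr'] at h₂ h₃
      exact ⟨c', h₁, h₂, h₃⟩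
    · obtain ⟨c', h₁, h₂, h₃⟩ := exists_pursuit_lt (c := c.swap) (r := r.swap) hT hS hr
        (by rwa [add_comm]) (by rwa [add_comm])
      refine ⟨c'.swap, (boxProdComm T S).map_rel_iff.2 h₁, ?_, ?_⟩
      · rw [add_comm]
        simpa [hr'] using h₂
      · rw [← pursuit_swap, ← pursuit_swap c]
        simpa [Prod.swap, hr'] using h₃
  obtain ⟨c', h₁, h₂, h₃⟩ := key
  exact ⟨fun _ => c', fun _ => Or.inr h₁, copsWin_boxProd_of_even hS hT c' r' h₂⟩
termination_by pursuit S T c r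
decreasing_by exact h₃

/-- On a product of two trees, one cop wins against a robber who may never stay. -/
theorem IsTree.allWin_boxProd [Finite U] [Finite V] (hS : S.IsTree) (hT : T.IsTree) :
    (S □ T).AllWin (S □ T).Adj 1 := by
  intro c r
  rw [show c = fun _ => c 0 from funext fun i => by rw [Subsingleton.elim i 0]]
  generalize c 0 = c
  by_cases h : Even (S.dist c.1 r.1 + T.dist c.2 r.2)
  · exact hS.copsWin_boxProd_of_even hT c r h
  -- With odd parity the cop waits one turn: the forced move of the robber makes it even.
  refine CopsWin.of_forall_exists fun r' hr =>
    ⟨fun _ => c, fun _ => Step.refl _ _, hS.copsWin_boxProd_of_even hT c r' ?_⟩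
  rw [Nat.even_iff] at h ⊢
  rcases boxProd_adj.1 hr with ⟨hr, hr'⟩ | ⟨hr, hr'⟩
  · have := hS.dist_eq_dist_add_one_of_adj c.1 hr
    rw [← hr']
    omega
  · have := hT.dist_eq_dist_add_one_of_adj c.2 hr
    rw [← hr']
    omega

end SimpleGraph

/-! ### Strategies and winning positions -/

namespace SimpleGraph

variable {W ι : Type*} {Γ : SimpleGraph W}

/-- `σ`, which gives the positions of the cops in terms of the past positions of the robber, is a
winning strategy. -/
def IsWinningStrategy (Γ : SimpleGraph W) (σ : List W → ι → W) : Prop :=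
  ∀ r : ℕ → W, (∀ n, Γ.Step (r n) (r (n + 1))) →
    (∀ n i, Γ.Step (σ ((List.range n).map r) i) (σ ((List.range (n + 1)).map r) i)) ∧
    ∃ n i, σ ((List.range n).map r) i = r n ∨ σ ((List.range (n + 1)).map r) i = r n

lemma map_range_succ {X : Type*} (r : ℕ → X) (n : ℕ) :
    (List.range (n + 1)).map r = r 0 :: (List.range n).map fun m => r (m + 1) := by
  rw [List.range_succ_eq_map, List.map_cons, List.map_map]
  rfl

/-- Otherwise the robber starts at a vertex where no answer of the cops reaches a winning position,
and he can keep this up forever, against `σ` in particular. -/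
lemma IsWinningStrategy.exists_placement {σ : List W → ι → W}
    (hσ : Γ.IsWinningStrategy σ) :
    ∀ r, ∃ c, (∀ i, Γ.Step (σ [] i) (c i)) ∧ Γ.CopsWin Γ.Step c r := by
  classical
  by_contra! hcon
  obtain ⟨r₀, h₀⟩ := hcon
  -- It is the turn of the cops here, whereas in `CopsWin` it is the turn of the robber.
  let Evades : (ι → W) → W → Prop := fun c x => ∀ c', (∀ i, Γ.Step (c i) (c' i)) →
    ¬ Γ.CopsWin Γ.Step c' x
  have hev : ∀ c x, ¬ Γ.CopsWin Γ.Step c x → ∃ x', Γ.Step x x' ∧ Evades c x' := by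
    intro c x hc
    by_contra! h
    refine hc (CopsWin.of_forall_exists fun x' hx => ?_)
    simpa [Evades] using h x' hx
  let next : List W → W → W := fun l x =>
    if h : ∃ x', Γ.Step x x' ∧ Evades (σ (l ++ [x])) x' then h.choose else x
  let s : ℕ → List W × W := fun n => (fun p => (p.1 ++ [p.2], next p.1 p.2))^[n] ([], r₀)
  have hs : ∀ n, s (n + 1) = ((s n).1 ++ [(s n).2], next (s n).1 (s n).2) :=
    fun n => Function.iterate_succ_apply' _ _ _
  let r : ℕ → W := fun n => (s n).2
  have hr : ∀ n, (s n).1 = (List.range n).map r := by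
    intro n
    induction n with
    | zero => rfl
    | succ n ih => rw [hs, List.range_succ, List.map_append, ← ih]; rfl
  have hrs : ∀ n, r (n + 1) = next ((List.range n).map r) (r n) := fun n => by
    rw [← hr]
    exact congrArg Prod.snd (hs n)
  have happ : ∀ n, (List.range n).map r ++ [r n] = (List.range (n + 1)).map r := fun n => by
    simp [List.range_succ]
  have hstep : ∀ n, Γ.Step (r n) (r (n + 1)) := by
    intro n
    rw [hrs]
    simp only [next]
    split_ifs with h
    · exact h.choose_spec.1
    · exact Step.refl _ _
  obtain ⟨hleg, n, i, hcap⟩ := hσ r hstep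
  have hevade : ∀ n, Evades (σ ((List.range n).map r)) (r n) := by
    intro n
    induction n with
    | zero => exact h₀
    | succ n ih =>
      have h := hev _ _ (ih _ (hleg n))
      rw [← happ] at h
      rw [hrs, ← happ]
      simp only [next, dif_pos h]
      exact h.choose_spec.2
  rcases hcap with h | h
  · exact hevade n _ (fun _ => Step.refl _ _) (.capture _ _ i h)
  · exact hevade n _ (hleg n) (.capture _ _ i h)

/-- The robber's history is read as a branch of the derivation of `CopsWin`: its head selects the
subtree, whose strategy handles the tail. -/
lemma CopsWin.exists_strategy {c : ι → W} {x : W} (h : Γ.CopsWin Γ.Step c x) :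
    ∃ τ : List W → ι → W, τ [] = c ∧ ∀ r : ℕ → W, Γ.Step x (r 0) →
      (∀ n, Γ.Step (r n) (r (n + 1))) →
      (∀ n i, Γ.Step (τ ((List.range n).map r) i) (τ ((List.range (n + 1)).map r) i)) ∧
      ((∃ i, c i = x) ∨ ∃ n i, τ ((List.range (n + 1)).map r) i = r n) := by
  classical
  induction h with
  | capture c x i h =>
    exact ⟨fun _ => c, rfl, fun r _ _ => ⟨fun _ _ => Step.refl _ _, Or.inl ⟨i, h⟩⟩⟩
  | move c x f hf _ ih =>
    have : Nonempty (List W → ι → W) := ⟨fun _ => c⟩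
    choose! τ hτ₀ hτ using ih
    refine ⟨fun l => l.rec c fun y l _ => τ y l, rfl, fun r hr₀ hr => ?_⟩
    obtain ⟨h₁, h₂⟩ := hτ (r 0) hr₀ (fun n => r (n + 1)) (hr 0) fun n => hr (n + 1)
    constructor
    · rintro (_ | n) i
      · simpa [hτ₀ _ hr₀] using hf _ hr₀ i
      · rw [map_range_succ, map_range_succ]
        exact h₁ n i
    · refine Or.inr ?_
      rcases h₂ with ⟨i, hi⟩ | ⟨n, i, hi⟩
      · exact ⟨0, i, by simpa [hτ₀ _ hr₀] using hi⟩
      · refine ⟨n + 1, i, ?_⟩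
        rw [map_range_succ]
        exact hi

lemma exists_isWinningStrategy {c₀ : ι → W}
    (h : ∀ r, ∃ c, (∀ i, Γ.Step (c₀ i) (c i)) ∧ Γ.CopsWin Γ.Step c r) :
    ∃ σ : List W → ι → W, Γ.IsWinningStrategy σ := by
  choose c hc hw using h
  choose τ hτ₀ hτ using fun r => (hw r).exists_strategy
  refine ⟨fun l => l.rec c₀ fun y l _ => τ y l, fun r hr => ?_⟩
  obtain ⟨h₁, h₂⟩ := hτ (r 0) (fun n => r (n + 1)) (hr 0) fun n => hr (n + 1)
  constructor
  · rintro (_ | n) i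
    · simpa [hτ₀] using hc _ i
    · rw [map_range_succ, map_range_succ]
      exact h₁ n i
  · rcases h₂ with ⟨i, hi⟩ | ⟨n, i, hi⟩
    · exact ⟨0, i, Or.inr (by simpa [hτ₀] using hi)⟩
    · refine ⟨n + 1, i, Or.inr ?_⟩
      rw [map_range_succ]
      exact hi

end SimpleGraph

/-! ### From hypergraphs to graphs -/

namespace Hypergraph

variable {α W : Type*} {H : Hypergraph α} {Γ : SimpleGraph W} {e : W → α}

/-- `e` is an isomorphism from `Γ` to the `2`-section of `H`. -/
structure IsModel (H : Hypergraph α) (Γ : SimpleGraph W) (e : W → α) : Prop where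
  injective : Function.Injective e
  range_eq : Set.range e = V(H)
  adj_iff : ∀ x y, Γ.Adj x y ↔ x ≠ y ∧ H.Adj (e x) (e y)

lemma isModel_twoSection (H : Hypergraph α) : H.IsModel H.twoSection Subtype.val :=
  ⟨Subtype.val_injective, Subtype.range_val, fun _ _ => Iff.rfl⟩

namespace IsModel

lemma mem (hM : H.IsModel Γ e) (x : W) : e x ∈ V(H) := hM.range_eq ▸ Set.mem_range_self x

lemma step_iff (hM : H.IsModel Γ e) {x y : W} : Γ.Step x y ↔ e y = e x ∨ H.Adj (e x) (e y) := by
  rw [SimpleGraph.Step, hM.adj_iff, hM.injective.eq_iff]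
  tauto

lemma isTrajectory (hM : H.IsModel Γ e) {r : ℕ → W} (hr : ∀ n, Γ.Step (r n) (r (n + 1))) :
    H.IsTrajectory fun n => e (r n) :=
  ⟨fun _ => hM.mem _, fun n => hM.step_iff.1 (hr n)⟩

lemma exists_eq (hM : H.IsModel Γ e) {w : ℕ → α} (hw : H.IsTrajectory w) :
    ∃ r : ℕ → W, (w = fun n => e (r n)) ∧ ∀ n, Γ.Step (r n) (r (n + 1)) := by
  have : ∀ n, ∃ x, e x = w n := fun n => by
    have := hw.1 n
    rwa [← hM.range_eq] at this
  choose r hr using this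
  refine ⟨r, funext fun n => (hr n).symm, fun n => hM.step_iff.2 ?_⟩
  rw [hr, hr]
  exact hw.2 n

lemma isCopWin_iff [Nonempty W] (hM : H.IsModel Γ e) (k : ℕ) :
    H.IsCopWin k ↔ ∃ σ : List W → Fin k → W, Γ.IsWinningStrategy σ := by
  have hinv : ∀ x, Function.invFun e (e x) = x := Function.leftInverse_invFun hM.injective
  constructor
  · rintro ⟨σ, hσ⟩
    refine ⟨fun l i => Function.invFun e (σ (l.map e) i), fun r hr => ?_⟩
    obtain ⟨h₁, n, i, h₂⟩ := hσ _ (hM.isTrajectory hr)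
    have hmap : ∀ n, ((List.range n).map r).map e = (List.range n).map fun m => e (r m) :=
      fun n => by rw [List.map_map]; rfl
    simp only [hmap]
    refine ⟨fun n i => ?_, n, i, h₂.imp (fun h => ?_) fun h => ?_⟩
    · obtain ⟨t, ht, hts⟩ := hM.exists_eq (h₁ i)
      have ht' := fun n => congrFun ht n
      rw [ht', ht', hinv, hinv]
      exact hts n
    · rw [h, hinv]
    · rw [h, hinv]
  · rintro ⟨σ, hσ⟩
    refine ⟨fun l i => e (σ (l.map (Function.invFun e)) i), fun w hw => ?_⟩
    obtain ⟨r, rfl, hr⟩ := hM.exists_eq hw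
    obtain ⟨h₁, n, i, h₂⟩ := hσ r hr
    have hmap : ∀ n, ((List.range n).map fun m => e (r m)).map (Function.invFun e) =
        (List.range n).map r := fun n => by simp [Function.comp_def, hinv]
    simp only [hmap]
    exact ⟨fun i => hM.isTrajectory fun n => h₁ n i, n, i,
      h₂.imp (fun h => by rw [h]) fun h => by rw [h]⟩

lemma exists_placement [Nonempty W] (hM : H.IsModel Γ e) {k : ℕ} (h : H.IsCopWin k) :
    ∃ c₀ : Fin k → W, ∀ r, ∃ c, (∀ i, Γ.Step (c₀ i) (c i)) ∧ Γ.CopsWin Γ.Step c r := by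
  obtain ⟨σ, hσ⟩ := (hM.isCopWin_iff k).1 h
  exact ⟨_, hσ.exists_placement⟩

lemma isCopWin_of_allWin [Nonempty W] (hM : H.IsModel Γ e) {k : ℕ} (h : Γ.AllWin Γ.Step k) :
    H.IsCopWin k :=
  (hM.isCopWin_iff k).2 <| SimpleGraph.exists_isWinningStrategy
    (c₀ := fun _ => Classical.arbitrary W) fun r => ⟨_, fun _ => SimpleGraph.Step.refl _ _, h _ r⟩

lemma copNumber_le [Nonempty W] (hM : H.IsModel Γ e) {k : ℕ} (h : Γ.AllWin Γ.Step k) :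
    H.copNumber ≤ k :=
  Nat.sInf_le (hM.isCopWin_of_allWin h)

/-- A cop on every vertex wins at once, so the infimum is over a nonempty set and is attained. -/
lemma isCopWin_copNumber [Nonempty W] [Finite W] (hM : H.IsModel Γ e) :
    H.IsCopWin H.copNumber := by
  refine Nat.sInf_mem (s := {k | H.IsCopWin k}) ⟨Nat.card W,
    (hM.isCopWin_iff _).2 ⟨fun _ => (Finite.equivFin W).symm,
    fun r _ => ⟨fun _ _ => SimpleGraph.Step.refl _ _, 0, Finite.equivFin W (r 0), Or.inl ?_⟩⟩⟩
  exact Equiv.symm_apply_apply _ _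

lemma allWin_copNumber [Finite W] (hM : H.IsModel Γ e) (hΓ : Γ.Connected) :
    Γ.AllWin Γ.Step H.copNumber := by
  have := hΓ.nonempty
  obtain ⟨c₀, hc₀⟩ := hM.exists_placement hM.isCopWin_copNumber
  exact .of_placement hΓ c₀ hc₀

end IsModel

end Hypergraph

namespace SimpleGraph

/-- The Cartesian product of a family of graphs. -/
def piBoxProd {ι : Type*} {V : ι → Type*} (G : ∀ i, SimpleGraph (V i)) :
    SimpleGraph (∀ i, V i) where
  Adj x y := ∃ i, (G i).Adj (x i) (y i) ∧ ∀ j, j ≠ i → x j = y j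
  symm := ⟨fun _ _ ⟨i, h, h'⟩ => ⟨i, h.symm, fun j hj => (h' j hj).symm⟩⟩
  loopless := ⟨fun _ ⟨_, h, _⟩ => h.ne rfl⟩

/-! ### Upper bound for products of several graphs -/

section Upper

lemma AllWin.of_iso {V W : Type*} {G : SimpleGraph V} {G' : SimpleGraph W} (φ : G ≃g G') {n : ℕ}
    (h : G'.AllWin G'.Step n) : G.AllWin G.Step n :=
  h.of_retract φ.symm φ φ.symm_apply_apply
    (fun _ _ => Or.imp (congrArg _) φ.symm.map_adj_iff.2)
    fun _ _ => Or.imp (congrArg _) φ.map_adj_iff.2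

/-- An isomorphism of the second factors of two products. -/
def boxProdCongrRight {U V W : Type*} (A : SimpleGraph U) {K : SimpleGraph V} {L : SimpleGraph W}
    (φ : K ≃g L) : boxProd A K ≃g boxProd A L :=
  ⟨(Equiv.refl U).prodCongr φ.toEquiv, fun {x y} => by
    simp [boxProd_adj, φ.map_adj_iff]⟩

variable {ι : Type*} {V : ι → Type*} (G : ∀ i, SimpleGraph (V i))

/-- Splitting off one factor of a product. -/
noncomputable def piBoxProdInsert {a : ι} {s : Set ι} (ha : a ∉ s) :
    piBoxProd (fun i : ↥(insert a s) => G i) ≃g G a □ piBoxProd (fun i : s => G i) := by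
  classical
  exact {
    toFun := fun x => (x ⟨a, Set.mem_insert a s⟩, fun i => x ⟨i, Set.mem_insert_of_mem a i.2⟩)
    invFun := fun y i => if h : (i : ι) = a then h.symm ▸ y.1 else y.2 ⟨i, i.2.resolve_left h⟩
    left_inv := fun x => by
      funext ⟨i, hi⟩
      by_cases h : i = a
      · subst h
        simp
      · simp [h]
    right_inv := fun y => by
      refine Prod.ext (by simp) (funext fun i => ?_)
      have h : (i : ι) ≠ a := fun h => ha (h ▸ i.2)
      simp [h]
    map_rel_iff' := fun {x y} => by
      simp only [Equiv.coe_fn_mk, boxProd_adj]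
      constructor
      · rintro (⟨h, h'⟩ | ⟨⟨i, h, h'⟩, h''⟩)
        · refine ⟨⟨a, Set.mem_insert a s⟩, h, ?_⟩
          rintro ⟨j, hj⟩ hja
          exact congrFun h' ⟨j, hj.resolve_left fun h => hja (Subtype.ext h)⟩
        · refine ⟨⟨i, Set.mem_insert_of_mem a i.2⟩, h, ?_⟩
          rintro ⟨j, rfl | hj⟩ hji
          · exact h''
          · exact h' ⟨j, hj⟩ fun h => hji (by subst h; rfl)
      · rintro ⟨⟨i, rfl | hi⟩, h, h'⟩
        · refine Or.inl ⟨h, funext fun j => h' _ fun hj => ha ?_⟩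
          exact Subtype.mk.inj hj ▸ j.2
        · refine Or.inr ⟨⟨⟨i, hi⟩, h, fun j hj => h' _ fun hj' => hj ?_⟩, h' _ fun hai => ha ?_⟩
          · exact Subtype.ext (Subtype.mk.inj hj')
          · exact Subtype.mk.inj hai ▸ hi }

/-- The product of the factors in `s` is connected, and `k` cops win on it. -/
def WinOn (s : Set ι) (k : ℕ) : Prop :=
  (piBoxProd fun i : s => G i).Connected ∧
    (piBoxProd fun i : s => G i).AllWin (piBoxProd fun i : s => G i).Step k

variable {G}

lemma WinOn.of_iso {W : Type*} {Γ : SimpleGraph W} {s : Set ι} {k : ℕ}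
    (φ : (piBoxProd fun i : s => G i) ≃g Γ) (hΓ : Γ.Connected) (h : Γ.AllWin Γ.Step k) :
    WinOn G s k :=
  ⟨φ.connected_iff.2 hΓ, h.of_iso φ⟩

lemma winOn_singleton {a : ι} (ha : (G a).Connected) {k : ℕ} (h : (G a).AllWin (G a).Step k) :
    WinOn G {a} k :=
  WinOn.of_iso (Γ := G a) ⟨Equiv.piUnique _, fun {x y} => by
    refine ⟨fun h => ⟨default, h, fun j hj => (hj (Subsingleton.elim _ _)).elim⟩, ?_⟩
    rintro ⟨i, h, -⟩
    rwa [Subsingleton.elim i default] at h⟩ ha h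

lemma WinOn.insert {a : ι} {s : Set ι} {k m : ℕ} (h : WinOn G s k) (has : a ∉ s)
    (ha : (G a).Connected) (ha' : (G a).AllWin (G a).Step m) : WinOn G (insert a s) (m + k) :=
  WinOn.of_iso (piBoxProdInsert G has) (ha.boxProd h.1) (.boxProd_add ha h.1 ha' h.2)

/-- The cop waits if the robber approaches and otherwise steps towards the vertex from which he
moved or where he stayed. Either the distance drops, or it is kept and the region beyond the robber
shrinks. -/
lemma IsTree.copsWin {W ι : Type*} [Finite W] [Nonempty ι] {T : SimpleGraph W} (hT : T.IsTree)
    (c r : W) : T.CopsWin T.Step (fun _ : ι => c) r := by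
  by_cases h₀ : c = r
  · exact .capture _ _ (Classical.arbitrary ι) h₀
  refine CopsWin.of_forall_exists fun r' hr => ?_
  have key : ∃ c', T.Step c c' ∧ toLex (T.dist c' r', (T.beyond c' r').ncard) <
      toLex (T.dist c r, (T.beyond c r).ncard) := by
    simp only [Prod.Lex.toLex_lt_toLex]
    obtain ⟨x, hx, hxr⟩ := hT.connected.exists_adj_dist_add_one h₀
    rcases hr with rfl | hr
    · exact ⟨x, Or.inr hx, by omega⟩
    rcases hT.dist_eq_dist_add_one_of_adj c hr with hd | hd
    · exact ⟨c, Step.refl _ _, by omega⟩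
    · have h₁ := hT.ncard_beyond_lt hr hd hx hxr
      have h₂ := hT.connected.dist_triangle (u := x) (v := r) (w := r')
      have h₃ := dist_eq_one_iff_adj.2 hr
      exact ⟨x, Or.inr hx, by omega⟩
  obtain ⟨c', h₁, h₂⟩ := key
  exact ⟨fun _ => c', fun _ => h₁, copsWin hT c' r'⟩
termination_by toLex (T.dist c r, (T.beyond c r).ncard)
decreasing_by exact h₂

/-- One cop wins on a tree. -/
lemma IsTree.allWin {W : Type*} [Finite W] {T : SimpleGraph W} (hT : T.IsTree) :
    T.AllWin T.Step 1 := by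
  intro c r
  rw [show c = fun _ => c 0 from funext fun i => by rw [Subsingleton.elim i 0]]
  exact hT.copsWin (c 0) r

/-- `AllWin.boxProd` applies with the product of both trees as `A` and `m = 1`. -/
lemma WinOn.insert_insert {a b : ι} {s : Set ι} {k : ℕ} (h : WinOn G s k) (hab : a ≠ b)
    (has : a ∉ s) (hbs : b ∉ s) [Finite (V a)] [Finite (V b)] (ha : (G a).IsTree)
    (hb : (G b).IsTree) : WinOn G (Insert.insert a (Insert.insert b s)) (k + 1) := by
  have hab' := ha.connected.boxProd hb.connected
  exact WinOn.of_iso (((piBoxProdInsert G (s := Insert.insert b s) (by simp [hab, has])).trans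
    (boxProdCongrRight _ (piBoxProdInsert G hbs))).trans (boxProdAssoc _ _ _).symm)
    (hab'.boxProd h.1) (AllWin.boxProd hab' h.1
      (.boxProd_add ha.connected hb.connected ha.allWin hb.allWin) (ha.allWin_boxProd hb) h.2)

lemma winOn_union [∀ i, Finite (V i)] {s : Set ι} {k : ℕ} (h : WinOn G s k) :
    ∀ (n : ℕ) (t : Finset ι), t.card = n → (∀ i ∈ t, i ∉ s) → (∀ i ∈ t, (G i).IsTree) →
      WinOn G (↑t ∪ s) ((n + 1) / 2 + k) := by
  classical
  intro n
  induction n using Nat.strong_induction_on with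
  | _ n ih =>
    intro t ht hts htree
    match n, ih, ht with
    | 0, _, ht => simpa [Finset.card_eq_zero.1 ht] using h
    | 1, _, ht =>
      obtain ⟨a, rfl⟩ := Finset.card_eq_one.1 ht
      have ha := htree a (by simp)
      simpa using h.insert (hts a (by simp)) ha.connected ha.allWin
    | n + 2, ih, ht =>
      obtain ⟨a, t', hat, rfl, ht'⟩ := Finset.card_eq_succ.1 ht
      obtain ⟨b, t, hbt, rfl, htn⟩ := Finset.card_eq_succ.1 ht'
      have := (ih n (by omega) t htn (fun i hi => hts i (by simp [hi]))
        fun i hi => htree i (by simp [hi])).insert_insert (a := a) (b := b) (by grind)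
        (by have := hts a; grind) (by have := hts b; grind) (htree a (by simp))
        (htree b (by simp))
      rw [show (n + 2 + 1) / 2 + k = (n + 1) / 2 + k + 1 by omega]
      simpa [Set.insert_union] using this

/-- Nonemptiness matters: the empty product is a single vertex, where zero cops do not win. -/
lemma winOn_of_allWin_one {s : Finset ι} (hs : s.Nonempty)
    (hG : ∀ i ∈ s, (G i).Connected ∧ (G i).AllWin (G i).Step 1) : WinOn G s s.card := by
  classical
  induction hs using Finset.Nonempty.cons_induction with
  | singleton a => simpa using winOn_singleton (hG a (by simp)).1 (hG a (by simp)).2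
  | cons a s ha hs ih =>
    have := (ih fun i hi => hG i (by simp [hi])).insert (a := a) (by simpa using ha)
      (hG a (by simp)).1 (hG a (by simp)).2
    rw [add_comm] at this
    rwa [Finset.card_cons, Finset.coe_cons]

lemma WinOn.allWin {k : ℕ} (h : WinOn G Set.univ k) :
    (piBoxProd G).AllWin (piBoxProd G).Step k := by
  refine h.2.of_retract (fun x i => x ⟨i, trivial⟩) (fun x i => x i) (fun _ => rfl)
    (fun x y => Or.imp (by rintro rfl; rfl) ?_) (fun x y => Or.imp (by rintro rfl; rfl) ?_)
  · rintro ⟨i, hi, hj⟩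
    exact ⟨i, hi, fun j hji => hj ⟨j, trivial⟩ fun h => hji (congrArg Subtype.val h)⟩
  · rintro ⟨i, hi, hj⟩
    exact ⟨⟨i, trivial⟩, hi, fun j hji => hj j fun h => hji (Subtype.ext h)⟩

end Upper

/-! ### Lower bounds by evasion -/

section Lower

/-- An invariant `P` that the robber can restore after every reply of the cops protects him forever.
-/
lemma CopsWin.not_forall_ne {V ι : Type*} {Γ : SimpleGraph V} (P : (ι → V) → V → Prop)
    (hP : ∀ c r, P c r → ∀ i, c i ≠ r)
    (h : ∀ c r, P c r → ∃ r', Γ.Step r r' ∧ ∀ c' : ι → V, (∀ i, Γ.Step (c i) (c' i)) → P c' r')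
    {c : ι → V} {r : V} (hc : Γ.CopsWin Γ.Step c r) : ¬ P c r := by
  induction hc with
  | capture c r i hi => exact fun hcr => hP c r hcr i hi
  | move c r f hf _ ih =>
    intro hcr
    obtain ⟨r', hr', hc'⟩ := h c r hcr
    exact ih r' hr' (hc' _ (hf r' hr'))

/-- One cop does not win on a product of two non-trivial graphs: after each move of the robber,
both his coordinates can differ from those of the cop. -/
lemma two_le_of_allWin_boxProd {U V : Type*} {A : SimpleGraph U} {K : SimpleGraph V} [Nontrivial U]
    [Nontrivial V] (hA : A.Connected) (hK : K.Connected) {n : ℕ}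
    (h : (A □ K).AllWin (A □ K).Step n) : 2 ≤ n := by
  by_contra! hn
  have h := h.of_le (Nat.le_of_lt_succ hn)
  obtain ⟨a, b, hab⟩ := exists_pair_ne U
  obtain ⟨k, l, hkl⟩ := exists_pair_ne V
  refine CopsWin.not_forall_ne (fun c r => c 0 ≠ r) (fun c r hc i => by
    rwa [Subsingleton.elim i 0]) (fun c r hc => ?_) (h (fun _ => (a, k)) (b, l)) (by simp [hab])
  have hstep : ∀ x y : U × V, (A □ K).Step x y → x.1 = y.1 ∨ x.2 = y.2 := fun x y hxy =>
    (step_boxProd.1 hxy).elim (fun h => Or.inr h.2) fun h => Or.inl h.1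
  suffices ∃ r', (A □ K).Step r r' ∧ (c 0).1 ≠ r'.1 ∧ (c 0).2 ≠ r'.2 by
    obtain ⟨r', hr, h₁, h₂⟩ := this
    refine ⟨r', hr, fun c' hc' h => ?_⟩
    have := hstep _ _ (hc' 0)
    rw [h] at this
    exact this.elim h₁ h₂
  by_cases h₁ : (c 0).1 = r.1
  · obtain ⟨x, hx⟩ := hA.preconnected.exists_adj_of_nontrivial r.1
    refine ⟨(x, r.2), step_boxProd.2 (Or.inl ⟨Or.inr hx, rfl⟩), h₁ ▸ hx.ne, fun h₂ => ?_⟩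
    exact hc (Prod.ext h₁ h₂)
  by_cases h₂ : (c 0).2 = r.2
  · obtain ⟨x, hx⟩ := hK.preconnected.exists_adj_of_nontrivial r.2
    exact ⟨(r.1, x), step_boxProd.2 (Or.inr ⟨rfl, Or.inr hx⟩), h₁, h₂ ▸ hx.ne⟩
  · exact ⟨r, Step.refl _ _, h₁, h₂⟩

variable {ι : Type*} {V : ι → Type*} {G : ∀ i, SimpleGraph (V i)}

lemma Step.exists_forall_ne_eq [Nonempty ι] {x y : ∀ i, V i} (h : (piBoxProd G).Step x y) :
    ∃ l, ∀ j, j ≠ l → x j = y j := by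
  rcases h with rfl | ⟨l, -, h⟩
  · exact ⟨Classical.arbitrary ι, fun _ _ => rfl⟩
  · exact ⟨l, h⟩

/-- Among the neighbours of `u` obtained by changing a coordinate to one of at most two given
values, at most two are in the closed neighbourhood of another vertex. -/
lemma card_filter_step_update_le_two [Fintype ι] [DecidableEq ι] {n : ι → ℕ} (hn : ∀ i, n i ≤ 2)
    {u v : ∀ i, V i} (f : ∀ i, Fin (n i) → V i) (hf : ∀ i, Function.Injective (f i))
    (hfu : ∀ i s, f i s ≠ u i) (huv : v ≠ u)
    [DecidablePred fun x : (i : ι) × Fin (n i) =>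
      (piBoxProd G).Step v (Function.update u x.1 (f x.1 x.2))] :
    (Finset.univ.filter fun x : (i : ι) × Fin (n i) =>
      (piBoxProd G).Step v (Function.update u x.1 (f x.1 x.2))).card ≤ 2 := by
  classical
  have hdom : ∀ x : (i : ι) × Fin (n i),
      (piBoxProd G).Step v (Function.update u x.1 (f x.1 x.2)) →
      v x.1 ≠ u x.1 ∧ ((∀ j, j ≠ x.1 → v j = u j) ∨
        v x.1 = f x.1 x.2 ∧ ∃ l, ∀ j, j ≠ x.1 → j ≠ l → v j = u j) := by
    intro x hx
    have : Nonempty ι := ⟨x.1⟩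
    obtain ⟨l, hl⟩ := hx.exists_forall_ne_eq
    by_cases hlx : x.1 = l
    · have h : ∀ j, j ≠ x.1 → v j = u j := fun j hj => by
        rw [hl j (hlx ▸ hj), Function.update_of_ne hj]
      refine ⟨fun h' => huv (funext fun j => ?_), Or.inl h⟩
      by_cases hj : j = x.1
      · exact hj ▸ h'
      · exact h j hj
    · have h : v x.1 = f x.1 x.2 := by rw [hl _ hlx, Function.update_self]
      refine ⟨h ▸ hfu _ _, Or.inr ⟨h, l, fun j hj hjl => ?_⟩⟩
      rw [hl j hjl, Function.update_of_ne hj]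
  -- If `v` differs from `u` only in coordinate `i`, the guarded exits all change `i`, and there are
  -- `n i ≤ 2` of these. Otherwise a guarded exit must agree with `v` in the coordinate it changes,
  -- which leaves one exit per coordinate and only two possible coordinates.
  by_cases h : ∃ i, ∀ j, j ≠ i → v j = u j
  · obtain ⟨i, hi⟩ := h
    refine (Finset.card_le_card (t := Finset.univ.image (Sigma.mk i)) ?_).trans
      (Finset.card_image_le.trans (by simpa using hn i))
    rintro ⟨j, s⟩ hx
    have hj := (hdom _ (Finset.mem_filter.1 hx).2).1
    obtain rfl : j = i := by_contra fun h => hj (hi j h)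
    simp
  · push Not at h
    have hdom' : ∀ x : (i : ι) × Fin (n i),
        (piBoxProd G).Step v (Function.update u x.1 (f x.1 x.2)) →
        v x.1 = f x.1 x.2 ∧ ∃ l, ∀ j, j ≠ x.1 → j ≠ l → v j = u j := fun x hx =>
      (hdom x hx).2.resolve_left fun h' => by
        obtain ⟨j, hj, hj'⟩ := h x.1
        exact hj' (h' j hj)
    by_contra! hlt
    obtain ⟨x₀, hx₀⟩ := Finset.card_pos.1 ((Nat.zero_le 2).trans_lt hlt)
    obtain ⟨-, l, hl⟩ := hdom' x₀ (Finset.mem_filter.1 hx₀).2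
    refine hlt.not_ge ((Finset.card_le_card_of_injOn Sigma.fst (t := {x₀.1, l}) ?_ ?_).trans
      Finset.card_le_two)
    · intro x hx
      have hx := (hdom x (Finset.mem_filter.1 hx).2).1
      by_contra hx'
      simp only [Finset.coe_insert, Finset.coe_singleton, Set.mem_insert_iff,
        Set.mem_singleton_iff, not_or] at hx'
      exact hx (hl _ hx'.1 hx'.2)
    · rintro ⟨i, s⟩ hx ⟨j, t⟩ hy (rfl : i = j)
      have hx := (hdom' _ (Finset.mem_filter.1 hx).2).1
      have hy := (hdom' _ (Finset.mem_filter.1 hy).2).1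
      exact congrArg (Sigma.mk i) (hf i (hx.symm.trans hy))

/-- If the `i`-th factor of a product has minimum degree at least `n i`, where `n i ≤ 2`, then less
than `(∑ i, n i) / 2` cops do not win. -/
theorem sum_le_two_mul_of_placement [Fintype ι] [∀ i, Nonempty (V i)] {n : ι → ℕ}
    (hn : ∀ i, n i ≤ 2)
    (hG : ∀ i x, ∃ f : Fin (n i) → V i, Function.Injective f ∧ ∀ s, (G i).Adj x (f s)) {k : ℕ}
    {c₀ : Fin k → ∀ i, V i}
    (h : ∀ r, ∃ c, (∀ i, (piBoxProd G).Step (c₀ i) (c i)) ∧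
      (piBoxProd G).CopsWin (piBoxProd G).Step c r) :
    ∑ i, n i ≤ 2 * k := by
  classical
  by_contra! hk
  choose f hf hadj using hG
  let g : (∀ i, V i) → ((i : ι) × Fin (n i)) → ∀ i, V i :=
    fun u x => Function.update u x.1 (f x.1 (u x.1) x.2)
  have hg : ∀ u x, (piBoxProd G).Step u (g u x) := fun u x =>
    Or.inr ⟨x.1, by simpa [g] using hadj _ _ _, fun j hj => by simp [g, hj]⟩
  have hcard : Fintype.card ((i : ι) × Fin (n i)) = ∑ i, n i := by simp
  have hsafe : ∀ (c : Fin k → ∀ i, V i) u, (∀ i, c i ≠ u) →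
      ∃ x, ∀ i, ¬ (piBoxProd G).Step (c i) (g u x) := by
    intro c u hu
    by_contra! hcon
    have hsub : (Finset.univ : Finset ((i : ι) × Fin (n i))) ⊆
        (Finset.univ : Finset (Fin k)).biUnion fun i =>
          Finset.univ.filter fun x => (piBoxProd G).Step (c i) (g u x) := by
      intro x _
      obtain ⟨i, hi⟩ := hcon x
      simpa using ⟨i, hi⟩
    have := (Finset.card_le_card hsub).trans (Finset.card_biUnion_le_card_mul _ _ 2 fun i _ =>
      card_filter_step_update_le_two hn (fun i => f i (u i)) (fun i => hf i (u i))
        (fun i s => (hadj i (u i) s).ne') (hu i))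
    rw [Finset.card_univ, Finset.card_univ, hcard, Fintype.card_fin] at this
    omega
  -- The exits from any vertex are distinct and number more than `k`, so the cops do not occupy all
  -- vertices.
  obtain ⟨u, hu⟩ : ∃ u, ∀ i, c₀ i ≠ u := by
    by_contra! hcon
    let u : ∀ i, V i := fun i => Classical.arbitrary _
    have hinj : Function.Injective (g u) := by
      rintro ⟨i, s⟩ ⟨j, t⟩ hxy
      simp only [g] at hxy
      have hi := congrFun hxy i
      rw [Function.update_self] at hi
      by_cases hij : i = j
      · subst hij
        rw [Function.update_self] at hi
        rw [hf i _ hi]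
      · rw [Function.update_of_ne hij] at hi
        exact ((hadj i (u i) s).ne' hi).elim
    choose i hi using hcon
    have := Fintype.card_le_of_injective (fun x => i (g u x)) fun x y hxy =>
      hinj ((hi (g u x)).symm.trans ((congrArg c₀ hxy).trans (hi (g u y))))
    rw [hcard, Fintype.card_fin] at this
    omega
  -- The robber starts at a safe exit of `u`, which the first move of the cops cannot reach.
  obtain ⟨x, hx⟩ := hsafe c₀ u hu
  obtain ⟨c, hc, hw⟩ := h (g u x)
  refine CopsWin.not_forall_ne (fun c r => ∀ i, c i ≠ r) (fun _ _ h => h) (fun c r hcr => ?_) hw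
    fun i hi => hx i (hi ▸ hc i)
  obtain ⟨y, hy⟩ := hsafe c r hcr
  exact ⟨g r y, hg r y, fun c' hc' i hi => hy i (hi ▸ hc' i)⟩

end Lower

end SimpleGraph

/-! ### Cop numbers of products of hypergraphs -/

namespace Hypergraph

lemma adj_box {α β : Type*} {G : Hypergraph α} {H : Hypergraph β} {x y : α × β}
    (hx : x ∈ V(G.box H)) :
    (G.box H).Adj x y ↔ G.Adj x.1 y.1 ∧ x.2 = y.2 ∨ x.1 = y.1 ∧ H.Adj x.2 y.2 := by
  constructor
  · rintro ⟨s, ⟨a, -, f, hf, rfl⟩ | ⟨f, hf, b, -, rfl⟩, hxs, hys⟩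
    · exact Or.inr ⟨hxs.1.trans hys.1.symm, f, hf, hxs.2, hys.2⟩
    · exact Or.inl ⟨⟨f, hf, hxs.1, hys.1⟩, hxs.2.trans hys.2.symm⟩
  · rintro (⟨⟨f, hf, hxf, hyf⟩, h⟩ | ⟨h, f, hf, hxf, hyf⟩)
    · exact ⟨_, Or.inr ⟨f, hf, x.2, hx.2, rfl⟩, ⟨hxf, rfl⟩, hyf, h.symm⟩
    · exact ⟨_, Or.inl ⟨x.1, hx.1, f, hf, rfl⟩, ⟨rfl, hxf⟩, h.symm, hyf⟩

lemma isModel_box {α β : Type*} (G : Hypergraph α) (H : Hypergraph β) :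
    (G.box H).IsModel (G.twoSection □ H.twoSection) (Prod.map Subtype.val Subtype.val) where
  injective := Subtype.val_injective.prodMap Subtype.val_injective
  range_eq := by
    rw [Set.range_prodMap, Subtype.range_val, Subtype.range_val]
    rfl
  adj_iff x y := by
    rw [adj_box ⟨x.1.2, x.2.2⟩]
    simp only [SimpleGraph.boxProd_adj, twoSection, Prod.map_fst, Prod.map_snd, ne_eq,
      Prod.ext_iff, Subtype.ext_iff]
    tauto

lemma isModel_piBox {ι : Type*} {α : ι → Type*} (F : ∀ i, Hypergraph (α i)) :
    (piBox F).IsModel (SimpleGraph.piBoxProd fun i => (F i).twoSection) fun x i => (x i).1 where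
  injective x y h := funext fun i => Subtype.ext (congrFun h i)
  range_eq := by
    refine Set.Subset.antisymm ?_ fun x hx => ⟨fun i => ⟨x i, hx i⟩, rfl⟩
    rintro _ ⟨x, rfl⟩ i
    exact (x i).2
  adj_iff x y := by
    constructor
    · rintro ⟨i, ⟨hne, e, he, hx, hy⟩, h⟩
      refine ⟨fun hxy => hne (congrFun hxy i), _,
        ⟨i, e, he, fun j => (x j).1, fun j => (x j).2, rfl⟩, ⟨hx, fun _ _ => rfl⟩, hy, fun j hj => congrArg Subtype.val (h j hj).symm⟩
    · rintro ⟨hne, _, ⟨i, e, he, a, -, rfl⟩, hx, hy⟩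
      have h : ∀ j, j ≠ i → x j = y j := fun j hj =>
        Subtype.ext ((hx.2 j hj).trans (hy.2 j hj).symm)
      refine ⟨i, ⟨fun hi => hne (funext fun j => ?_), e, he, hx.1, hy.1⟩, h⟩
      by_cases hj : j = i
      · exact hj ▸ hi
      · exact h j hj

section Box

variable {α β : Type*} {G : Hypergraph α} {H : Hypergraph β}

lemma allWin_copNumber_box (hG : V(G).Finite) (hH : V(H).Finite) (hGc : G.twoSection.Connected)
    (hHc : H.twoSection.Connected) : (G.twoSection □ H.twoSection).AllWin
      (G.twoSection □ H.twoSection).Step (G.box H).copNumber := by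
  have := hG.to_subtype
  have := hH.to_subtype
  exact (isModel_box G H).allWin_copNumber (hGc.boxProd hHc)

theorem copNumber_box_le (hG : V(G).Finite) (hH : V(H).Finite) (hGc : G.twoSection.Connected)
    (hHc : H.twoSection.Connected) : (G.box H).copNumber ≤ G.copNumber + H.copNumber := by
  have := hG.to_subtype
  have := hH.to_subtype
  have := (hGc.boxProd hHc).nonempty
  exact (isModel_box G H).copNumber_le (.boxProd_add hGc hHc
    (G.isModel_twoSection.allWin_copNumber hGc) (H.isModel_twoSection.allWin_copNumber hHc))

theorem max_copNumber_le_copNumber_box (hG : V(G).Finite) (hH : V(H).Finite)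
    (hGc : G.twoSection.Connected) (hHc : H.twoSection.Connected) (hGn : V(G).Nontrivial)
    (hHn : V(H).Nontrivial) :
    max (max G.copNumber H.copNumber) 2 ≤ (G.box H).copNumber := by
  have h := allWin_copNumber_box hG hH hGc hHc
  have := hGn.coe_sort
  have := hHn.coe_sort
  obtain ⟨a⟩ := hGc.nonempty
  obtain ⟨b⟩ := hHc.nonempty
  refine max_le (max_le (G.isModel_twoSection.copNumber_le ?_)
    (H.isModel_twoSection.copNumber_le ?_)) (SimpleGraph.two_le_of_allWin_boxProd hGc hHc h)
  · refine h.of_retract Prod.fst (fun x => (x, b)) (fun _ => rfl) (fun x y hxy => ?_)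
      fun x y => SimpleGraph.step_boxProd_of_left
    exact (SimpleGraph.step_boxProd.1 hxy).elim And.left fun h => Or.inl h.1
  · refine h.of_retract Prod.snd (fun x => (a, x)) (fun _ => rfl) (fun x y hxy => ?_)
      fun x y => SimpleGraph.step_boxProd_of_right
    exact (SimpleGraph.step_boxProd.1 hxy).elim (fun h => Or.inl h.2) And.right

end Box

lemma ceil_half (p : ℕ) : ⌈(p : ℚ) / 2⌉₊ = (p + 1) / 2 := by
  refine le_antisymm (Nat.ceil_le.2 ?_) ?_
  · have : (p : ℚ) ≤ 2 * ((p + 1) / 2 : ℕ) := by exact_mod_cast (by omega)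
    linarith
  · have h : (p : ℚ) ≤ 2 * (⌈(p : ℚ) / 2⌉₊ : ℕ) := by
      have := Nat.le_ceil ((p : ℚ) / 2)
      linarith
    have h' : p ≤ 2 * ⌈(p : ℚ) / 2⌉₊ := by exact_mod_cast h
    omega

section Pi

variable {p q : ℕ} {α : Fin p ⊕ Fin q → Type*} (F : ∀ i, Hypergraph (α i))

theorem copNumber_piBox_le [∀ i, Finite V(F i)] (hq : 1 ≤ q)
    (hT : ∀ i, (F (Sum.inl i)).twoSection.IsTree)
    (hH : ∀ j, (F (Sum.inr j)).twoSection.Connected ∧ (F (Sum.inr j)).copNumber = 1) :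
    (piBox F).copNumber ≤ (p + 1) / 2 + q := by
  have hne : ∀ i, Nonempty V(F i) := by
    rintro (i | j)
    · exact (hT i).connected.nonempty
    · exact (hH j).1.nonempty
  have : NeZero q := ⟨by omega⟩
  have h := SimpleGraph.winOn_of_allWin_one (G := fun i => (F i).twoSection)
    (s := Finset.univ.map (Function.Embedding.inr : Fin q ↪ Fin p ⊕ Fin q)) (by simp) (by
      simp only [Finset.mem_map, Finset.mem_univ, true_and]
      rintro _ ⟨j, rfl⟩
      refine ⟨(hH j).1, ?_⟩
      have := (F (Sum.inr j)).isModel_twoSection.allWin_copNumber (hH j).1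
      rwa [(hH j).2] at this)
  have h := SimpleGraph.winOn_union h p
    (Finset.univ.map (Function.Embedding.inl : Fin p ↪ Fin p ⊕ Fin q)) (by simp) (by simp) (by
      simp only [Finset.mem_map, Finset.mem_univ, true_and]
      rintro _ ⟨i, rfl⟩
      exact hT i)
  refine (isModel_piBox F).copNumber_le (SimpleGraph.WinOn.allWin ?_)
  convert h using 1
  · ext (i | j) <;> simp
  · simp

theorem le_two_mul_copNumber_piBox [∀ i, Finite V(F i)]
    (hT : ∀ i, (F (Sum.inl i)).twoSection.Connected ∧ V(F (Sum.inl i)).Nontrivial)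
    (hH : ∀ j, (F (Sum.inr j)).twoSection.Connected ∧ ∀ x, ∃ f : Fin 2 → V(F (Sum.inr j)),
      Function.Injective f ∧ ∀ s, (F (Sum.inr j)).twoSection.Adj x (f s)) :
    p + q * 2 ≤ 2 * (piBox F).copNumber := by
  have hne : ∀ i, Nonempty V(F i) := by
    rintro (i | j)
    · exact (hT i).1.nonempty
    · exact (hH j).1.nonempty
  obtain ⟨c₀, hc₀⟩ := (isModel_piBox F).exists_placement (isModel_piBox F).isCopWin_copNumber
  have := SimpleGraph.sum_le_two_mul_of_placement (n := Sum.elim (fun _ => 1) fun _ => 2)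
    (by rintro (i | j) <;> simp) (by
      rintro (i | j) x
      · have := (hT i).2.coe_sort
        obtain ⟨y, hy⟩ := (hT i).1.preconnected.exists_adj_of_nontrivial x
        exact ⟨fun _ => y, fun s t _ => Subsingleton.elim (α := Fin 1) s t, fun _ => hy⟩
      · exact (hH j).2 x) hc₀
  simpa using this

end Pi

end Hypergraph

lemma SimpleGraph.exists_injective_of_le_minDegree {W : Type*} [Fintype W] {Γ : SimpleGraph W}
    [DecidableRel Γ.Adj] {n : ℕ} (h : n ≤ Γ.minDegree) (x : W) :
    ∃ f : Fin n → W, Function.Injective f ∧ ∀ s, Γ.Adj x (f s) := by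
  obtain ⟨f⟩ : Nonempty (Fin n ↪ Γ.neighborSet x) := Function.Embedding.nonempty_of_card_le (by
    rw [Γ.card_neighborSet_eq_degree, Fintype.card_fin]
    exact h.trans (Γ.minDegree_le_degree x))
  exact ⟨fun s => f s, Subtype.val_injective.comp f.injective, fun s => (f s).2⟩

theorem theorem4p2 :
    (∀ {α : Type*} {β : Type*} (G : Hypergraph α) (H : Hypergraph β),
      V(G).Finite → V(H).Finite →
      G.twoSection.Connected → H.twoSection.Connected →
      V(G).Nontrivial → V(H).Nontrivial →
      max (max G.copNumber H.copNumber) 2 ≤ (G.box H).copNumber ∧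
      (G.box H).copNumber ≤ G.copNumber + H.copNumber ∧
      (G.copNumber = 1 → H.copNumber = 1 → (G.box H).copNumber = 2)) ∧
    (∀ (p q : ℕ) {α : Fin p ⊕ Fin q → Type*} (F : ∀ i, Hypergraph (α i))
      [∀ i, Fintype V(F i)] [∀ i, DecidableRel (F i).twoSection.Adj],
      1 ≤ q →
      (∀ i : Fin p, (F (Sum.inl i)).IsTree ∧ V(F (Sum.inl i)).Nontrivial) →
      (∀ j : Fin q, (F (Sum.inr j)).twoSection.Connected ∧ (F (Sum.inr j)).copNumber = 1 ∧
        2 ≤ (F (Sum.inr j)).twoSection.minDegree) →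
      (Hypergraph.piBox F).copNumber = ⌈(p : ℚ) / 2⌉₊ + q) := by
  refine ⟨fun G H hG hH hGc hHc hGn hHn => ?_, fun p q α F _ _ hq hT hH => ?_⟩
  · have h₁ := Hypergraph.max_copNumber_le_copNumber_box hG hH hGc hHc hGn hHn
    have h₂ := Hypergraph.copNumber_box_le hG hH hGc hHc
    exact ⟨h₁, h₂, fun _ _ => by omega⟩
  · have h₁ := Hypergraph.copNumber_piBox_le F hq (fun i => (hT i).1.2)
      fun j => ⟨(hH j).1, (hH j).2.1⟩
    have h₂ := Hypergraph.le_two_mul_copNumber_piBox F (fun i => ⟨(hT i).1.2.connected, (hT i).2⟩)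
      fun j => ⟨(hH j).1, SimpleGraph.exists_injective_of_le_minDegree (hH j).2.2⟩
    rw [Hypergraph.ceil_half]
    omega
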